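/- Consider off-policy evaluation in a partially observed Markov decision process with observed state $X_t\in\mathcal X$, hidden state $H_t\in\mathcal H$ ($\mathcal X$ and $\mathcal H$ finite), action $W_t\in\{1,\dots,A\}$ and outcome $Y_t\in\mathbb R$. An instance $I$ consists of * an observed state space $\mathcal X$, a hidden state space $\mathcal H$ and a number of actions $A$; * for each $(x,h,w)$, a probability distribution on $\mathbb R\times\mathcal X\times\mathcal H$, from which $(Y_t,X_{t+1},H_{t+1})$ is drawn, conditionally on the past, when $(X_t,H_t,W_t)=(x,h,w)$; * a target policy $\pi$ and a behavior policy $e$, each mapping the observed state $x$ to action probabilities $\pi_a(x)$, $e_a(x)$. Write $P^\pi$ and $P^e$ for the transition matrices of $(X_t,H_t)$ when actions are drawn from $\pi(X_t)$, respectively from $e(X_t)$. For $t_0>0$, $\zeta_\pi\ge 0$, $M_1>0$, $M_2>0$, let $\mathcal I=\mathcal I(t_0,\zeta_\pi,M_1,M_2)$ be the class of all instances such that * (overlap) $\pi_a(x)\le e^{\zeta_\pi}e_a(x)$ for all $a$ and $x$; * (mixing) $\|f'P-fP\|_{\mathrm{TV}}\le e^{-1/t_0}\|f'-f\|_{\mathrm{TV}}$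 for all probability distributions $f,f'$ on $\mathcal X\times\mathcal H$ and both $P=P^\pi$ and $P=P^e$; * (moments) $|\mathbb E[Y_t\mid X_t,H_t,W_t]|\le M_1$ and $\mathbb E[Y_t^2\mid X_t,H_t,W_t]\le M_2$ for all values of $(X_t,H_t,W_t)$. Let $V(I)$ be the long-term reward of the target policy, i.e. the expectation of $Y_t$ when $(X_t,H_t)$ follows the stationary distribution of $P^\pi$ and $W_t\sim\pi(X_t)$. The data are one observed trajectory $(X_t,W_t,Y_t)_{t=1}^T$ generated under the behavior policy $e$, with $(X_1,H_1)$ drawn from the stationary distribution of $P^e$. Estimators $\hat V$ are measurable functions of the data that may also depend on the design $(\mathcal X,A,\pi,e)$, and $$R_{\mathrm{minimax}}^{T}(\mathcal I)=\inf_{\hat V}\ \sup_{I\in\mathcal I}\ \mathbb E^{I}\big[(\hat V-V(I))^2\big].$$ Then there is a constant $C=C(t_0,\zeta_\pi,M_1,M_2)>0$ such that for every $T\ge 1$ $$R_{\mathrm{minimax}}^{T}\big(\mathcal I(t_0,\zeta_\pi,M_1,M_2)\big)\ \ge\ C\max\Big\{T^{-\frac{2}{t_0\zeta_\pi+1}},\,T^{-1}\Big\}.$$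 -/

import Mathlib

open MeasureTheory

noncomputable section

namespace POMDP

/-! ### Finite Markov chains: total-variation contraction and stationary distributions -/

section Chains

/-- `f ↦ f P` is a contraction in total variation (half the `ℓ¹` distance, so the factor `1/2` cancels)
with constant `exp (-1/t)` on pairs of probability distributions: the chain `P` has mixing time
at most `t`. -/
def MixesWithin {S : Type*} [Fintype S] (P : Matrix S S ℝ) (t : ℝ) : Prop :=
  ∀ f ∈ stdSimplex ℝ S, ∀ f' ∈ stdSimplex ℝ S,
    ∑ s, |Matrix.vecMul f' P s - Matrix.vecMul f P s| ≤ Real.exp (-1 / t) * ∑ s, |f' s - f s|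

/-- `ρ` is a stationary probability distribution of `P`. -/
def IsStationary {S : Type*} [Fintype S] (P : Matrix S S ℝ) (ρ : S → ℝ) : Prop :=
  ρ ∈ stdSimplex ℝ S ∧ Matrix.vecMul ρ P = ρ

open Classical in
/-- The stationary distribution of `P` (`0` if there is none). A stochastic matrix with a finite
mixing time has exactly one: see `existsUnique_isStationary`. -/
def stationaryDist {S : Type*} [Fintype S] (P : Matrix S S ℝ) : S → ℝ :=
  if h : ∃ ρ, IsStationary P ρ then h.choose else 0

/-- Well-definedness: on a non-empty finite state space, a stochastic matrix with mixing time at most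
`t`, where `0 < t < ∞`, has exactly one stationary distribution. -/
theorem existsUnique_isStationary {S : Type*} [Fintype S] [Nonempty S] {P : Matrix S S ℝ} {t : ℝ}
    (ht : 0 < t) (hP : ∀ s, P s ∈ stdSimplex ℝ S) (hmix : MixesWithin P t) :
    ∃! ρ, IsStationary P ρ := by
  classical
  have hc : Real.exp (-1 / t) < 1 := by
    rw [Real.exp_lt_one_iff]
    exact div_neg_of_neg_of_pos (by norm_num) ht
  have hstep : ∀ f ∈ stdSimplex ℝ S, Matrix.vecMul f P ∈ stdSimplex ℝ S := by
    intro f hf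
    refine ⟨fun s => ?_, ?_⟩
    · exact Finset.sum_nonneg fun i _ => mul_nonneg (hf.1 i) ((hP i).1 s)
    · simp only [Matrix.vecMul, dotProduct]
      rw [Finset.sum_comm]
      simp_rw [← Finset.mul_sum, (hP _).2, mul_one]
      exact hf.2
  have hzero : ∀ f f' : S → ℝ, ∑ s, |f' s - f s| ≤ 0 → f' = f := by
    intro f f' h
    funext s
    have h0 : ∑ s, |f' s - f s| = 0 := le_antisymm h (Finset.sum_nonneg fun _ _ => abs_nonneg _)
    have := (Finset.sum_eq_zero_iff_of_nonneg (fun _ _ => abs_nonneg _)).1 h0 s (Finset.mem_univ s)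
    exact sub_eq_zero.1 (abs_eq_zero.1 this)
  have hcont : Continuous fun f : S → ℝ => ∑ s, |Matrix.vecMul f P s - f s| := by
    simp only [Matrix.vecMul, dotProduct]
    fun_prop
  obtain ⟨ρ, hρ, hmin⟩ := (isCompact_stdSimplex ℝ S).exists_isMinOn
    ⟨_, single_mem_stdSimplex ℝ (Classical.arbitrary S)⟩ hcont.continuousOn
  have h1 := hmin (hstep ρ hρ)
  have h2 := hmix ρ hρ _ (hstep ρ hρ)
  simp only [Set.mem_ofPred_eq] at h1
  refine ⟨ρ, ⟨hρ, hzero _ _ ?_⟩, ?_⟩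
  · nlinarith
  · rintro ρ' ⟨hρ', hs'⟩
    have hs : Matrix.vecMul ρ P = ρ := hzero _ _ (by nlinarith)
    have h3 := hmix ρ hρ ρ' hρ'
    rw [hs, hs'] at h3
    exact hzero _ _ (by nlinarith)

/-- `stationaryDist` is stationary whenever a stationary distribution exists. -/
theorem isStationary_stationaryDist {S : Type*} [Fintype S] {P : Matrix S S ℝ}
    (h : ∃ ρ, IsStationary P ρ) : IsStationary P (stationaryDist P) := by
  rw [stationaryDist, dif_pos h]
  exact h.choose_spec

end Chains

/-! ### Trajectories -/

section Trajectories

/-- The law of `(X_t, H_t, W_t, Y_t)`, `t = 1, …, T`, from the state `(X_1, H_1) = s`: at each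
time `W_t ∼ e(X_t)`, and then `(Y_t, (X_{t+1}, H_{t+1})) ∼ K (X_t, H_t) W_t`. -/
def trajLaw {X H A : Type*} [MeasurableSpace X] [MeasurableSpace H] [MeasurableSpace A] [Fintype A]
    (K : X × H → A → Measure (ℝ × (X × H))) (e : X → A → ℝ) :
    (T : ℕ) → X × H → Measure (Fin T → (X × H) × A × ℝ)
  | 0, _ => Measure.dirac Fin.elim0
  | T + 1, s => ∑ a, ENNReal.ofReal (e s.1 a) •
      (K s a).bind fun z => (trajLaw K e T z.2).map fun d =>
        (Fin.cons (s, a, z.1) d : Fin (T + 1) → (X × H) × A × ℝ)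

/-- The part of a trajectory that is observed: `(X_t, W_t, Y_t)`, without `H_t`. -/
def observe {X H A : Type*} {T : ℕ} (d : Fin T → (X × H) × A × ℝ) : Fin T → X × A × ℝ :=
  fun t => ((d t).1.1, (d t).2)

end Trajectories

/-! ### Problem instances -/

/-- What the analyst knows: the observed state space `{1, …, nX}`, the actions `{1, …, nA}`, the
target policy `π` and the behavior policy `e`; both map an observed state to action probabilities. -/
structure Design where
  nX : ℕ
  nA : ℕ
  target : Fin nX → Fin nA → ℝ
  behavior : Fin nX → Fin nA → ℝ
  target_mem : ∀ x, target x ∈ stdSimplex ℝ (Fin nA)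
  behavior_mem : ∀ x, behavior x ∈ stdSimplex ℝ (Fin nA)

/-- An off-policy evaluation problem in a POMDP with finite state space: a design, a finite hidden
state space, and for each state `(x, h)` and action `w` the joint law of the outcome `Y_t` and the
next state `(X_{t+1}, H_{t+1})`. -/
structure Instance extends Design where
  nH : ℕ
  kernel : Fin nX × Fin nH → Fin nA → Measure (ℝ × (Fin nX × Fin nH))
  isProb : ∀ s a, IsProbabilityMeasure (kernel s a)

namespace Instance

/-- The state space of `(X_t, H_t)`. -/
abbrev State (I : Instance) : Type := Fin I.nX × Fin I.nH

/-- The transition matrix of `(X_t, H_t)` when actions follow the policy `p`. -/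
def transition (I : Instance) (p : Fin I.nX → Fin I.nA → ℝ) : Matrix I.State I.State ℝ :=
  fun s s' => ∑ a, p s.1 a * (I.kernel s a).real (Set.univ ×ˢ {s'})

/-- `E[Y_t | (X_t, H_t) = s, W_t = a]`. -/
def meanOutcome (I : Instance) (s : I.State) (a : Fin I.nA) : ℝ :=
  ∫ z, z.1 ∂(I.kernel s a)

/-- The long-term reward `V(I)`: the expectation of `Y_t` in the stationary regime of the target
policy. -/
def value (I : Instance) : ℝ :=
  ∑ s, stationaryDist (I.transition I.target) s * ∑ a, I.target s.1 a * I.meanOutcome s a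

/-- The law of the observed data `(X_t, W_t, Y_t)`, `t = 1, …, T`: one trajectory under the behavior
policy, whose initial state has the stationary distribution of that policy. -/
def dataLaw (I : Instance) (T : ℕ) : Measure (Fin T → Fin I.nX × Fin I.nA × ℝ) :=
  (∑ s, ENNReal.ofReal (stationaryDist (I.transition I.behavior) s) •
    trajLaw I.kernel I.behavior T s).map observe

/-- The class of instances with mixing time at most `t₀` (under the target and under the behavior
policy), overlap constant `ζ`, and bounds `M₁`, `M₂` on the conditional first and second
moments of the outcome. -/
structure InClass (I : Instance) (t₀ ζ M₁ M₂ : ℝ) : Prop where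
  nonempty : Nonempty I.State
  overlap : ∀ x a, I.target x a ≤ Real.exp ζ * I.behavior x a
  mixing_target : MixesWithin (I.transition I.target) t₀
  mixing_behavior : MixesWithin (I.transition I.behavior) t₀
  second_moment : ∀ s a, ∫⁻ z, ENNReal.ofReal (z.1 ^ 2) ∂(I.kernel s a) ≤ ENNReal.ofReal M₂
  first_moment : ∀ s a, |I.meanOutcome s a| ≤ M₁

end Instance

/-! ### Estimators and the minimax risk -/

/-- An estimator from a trajectory of length `T`: a measurable function of the observed data,
which may depend on the design (in particular on both policies). -/
def Estimator (T : ℕ) : Type :=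
  (D : Design) → {v : (Fin T → Fin D.nX × Fin D.nA × ℝ) → ℝ // Measurable v}

/-- The mean-squared error of an estimator under the instance `I`. -/
def mse {T : ℕ} (v : Estimator T) (I : Instance) : ENNReal :=
  ∫⁻ d, ENNReal.ofReal (((v I.toDesign).1 d - I.value) ^ 2) ∂(I.dataLaw T)

/-- The minimax risk over the class of instances with parameters `t₀`, `ζ`, `M₁`, `M₂`. -/
def minimaxRisk (T : ℕ) (t₀ ζ M₁ M₂ : ℝ) : ENNReal :=
  ⨅ v : Estimator T, ⨆ (I : Instance) (_ : I.InClass t₀ ζ M₁ M₂), mse v I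

end POMDP

end

/-! The bound is a two-point argument on a hidden ladder of levels `0, …, k`. There is one observed
state, so the level is invisible. Action `1` climbs one level with probability `r = exp (-1/t₀)` and
otherwise resets to level `0`; action `0` always resets. The target policy always plays `1`, the
behavior policy only with probability `p = exp (-ζ)`. Outcomes are `± c`, with bias `ε` at the top
and none elsewhere.

The top has stationary probability `r ^ k` under the target policy but `(r * p) ^ k` under the
behavior policy (`IsStationary.apply_last`). Hence biases `ε` and `-ε` give values `± r ^ k * c *
ε`, while the two data laws differ only through visits to the top. Each visit costs at most a factor
`1 - ε ^ 2` in Hellinger affinity, so the affinity is at least `1 - T * (r * p) ^ k * ε ^ 2`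
(`survival_le_affinity`, `one_sub_le_sum_ladderSurvival`). This holds even if the levels are
revealed.

When the loss is at most `1/8`, no estimator does well under both signs
(`le_minimaxRisk_of_ladder`). Height `0` with `ε` of order `T ^ (-1/2)` gives the rate `T⁻¹`. Bias
`1` with `(r * p) ^ k` of order `1 / T` gives `r ^ (2 * k)`, of order `T ^ (-2 / (t₀ * ζ + 1))`. -/

open MeasureTheory
open scoped ENNReal

noncomputable section

namespace POMDP

/-! ### Finitely supported measures -/

section Atomic

variable {ι α : Type*} [Fintype ι] [MeasurableSpace α]

/-- The measure with mass `w i` at the point `z i` for every `i`. -/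
def atomic (w : ι → ℝ) (z : ι → α) : Measure α :=
  ∑ i, ENNReal.ofReal (w i) • Measure.dirac (z i)

theorem aemeasurable_atomic [MeasurableSingletonClass α] {β : Type*} [MeasurableSpace β]
    (w : ι → ℝ) (z : ι → α) (f : α → β) : AEMeasurable f (atomic w z) := by
  rw [atomic, ← Measure.sum_fintype, aemeasurable_sum_measure_iff]
  exact fun i => aemeasurable_dirac.smul_measure _

theorem lintegral_atomic [MeasurableSingletonClass α] (w : ι → ℝ) (z : ι → α) (f : α → ℝ≥0∞) :
    ∫⁻ x, f x ∂atomic w z = ∑ i, ENNReal.ofReal (w i) * f (z i) := by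
  simp [atomic, lintegral_smul_measure, lintegral_dirac]

theorem integral_atomic [MeasurableSingletonClass α] {w : ι → ℝ} (hw : ∀ i, 0 ≤ w i) (z : ι → α)
    (f : α → ℝ) : ∫ x, f x ∂atomic w z = ∑ i, w i * f (z i) := by
  rw [atomic, integral_finsetSum_measure]
  · simp [integral_smul_measure, integral_dirac, ENNReal.toReal_ofReal, hw]
  · intro i _
    exact (integrable_dirac (by simp)).smul_measure ENNReal.ofReal_ne_top

theorem isProbabilityMeasure_atomic {w : ι → ℝ} (hw : ∀ i, 0 ≤ w i) (h1 : ∑ i, w i = 1)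
    (z : ι → α) : IsProbabilityMeasure (atomic w z) := by
  refine ⟨?_⟩
  simp [atomic, ← ENNReal.ofReal_sum_of_nonneg fun i _ => hw i, h1]

open Classical in
theorem real_atomic {w : ι → ℝ} (hw : ∀ i, 0 ≤ w i) (z : ι → α) {B : Set α}
    (hB : MeasurableSet B) :
    (atomic w z).real B = ∑ i, w i * if z i ∈ B then 1 else 0 := by
  simp only [atomic, Measure.real, Measure.finsetSum_apply, Measure.smul_apply,
    Measure.dirac_apply' _ hB, smul_eq_mul, Set.indicator_apply, Pi.one_apply]
  rw [ENNReal.toReal_sum]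
  · refine Finset.sum_congr rfl fun i _ => ?_
    split_ifs <;> simp [hw]
  · intro i _
    split_ifs <;> simp

end Atomic

/-! ### Hellinger affinity of trajectory laws -/

section Affinity

/-- Cauchy–Schwarz for sums in `ℝ≥0∞`. -/
theorem sum_le_sqrt_mul_sqrt {ι : Type*} [Fintype ι] {r x y : ι → ℝ≥0∞}
    (h : ∀ i, r i ≤ x i ^ (1 / 2 : ℝ) * y i ^ (1 / 2 : ℝ)) :
    ∑ i, r i ≤ (∑ i, x i) ^ (1 / 2 : ℝ) * (∑ i, y i) ^ (1 / 2 : ℝ) := by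
  refine (Finset.sum_le_sum fun i _ => h i).trans ?_
  have := ENNReal.inner_le_Lp_mul_Lq Finset.univ (fun i => x i ^ (1 / 2 : ℝ))
    (fun i => y i ^ (1 / 2 : ℝ)) Real.HolderConjugate.two_two
  have hsq : ∀ t : ℝ≥0∞, (t ^ (1 / 2 : ℝ)) ^ (2 : ℝ) = t := fun t => by
    rw [← ENNReal.rpow_mul]; norm_num
  simpa only [hsq] using this

/-- The geometric mean of weighted quantities dominates the product of the weights' geometric mean
and that of the quantities. -/
theorem ofReal_mul_le_sqrt_mul_sqrt {u a p q : ℝ} {x y : ℝ≥0∞} (hu : 0 ≤ u) (hp : 0 ≤ p)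
    (hq : 0 ≤ q) (h : u ^ 2 ≤ p * q)
    (ha : ENNReal.ofReal a ≤ x ^ (1 / 2 : ℝ) * y ^ (1 / 2 : ℝ)) :
    ENNReal.ofReal (u * a) ≤
      (ENNReal.ofReal p * x) ^ (1 / 2 : ℝ) * (ENNReal.ofReal q * y) ^ (1 / 2 : ℝ) := by
  rw [ENNReal.ofReal_mul hu, ENNReal.mul_rpow_of_nonneg _ _ (by norm_num),
    ENNReal.mul_rpow_of_nonneg _ _ (by norm_num), mul_mul_mul_comm]
  refine mul_le_mul' ?_ ha
  rw [ENNReal.ofReal_rpow_of_nonneg hp (by norm_num),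
    ENNReal.ofReal_rpow_of_nonneg hq (by norm_num), ← ENNReal.ofReal_mul (by positivity),
    ← Real.mul_rpow hp hq, ← Real.sqrt_eq_rpow]
  exact ENNReal.ofReal_le_ofReal (Real.le_sqrt_of_sq_le h)

theorem measurable_fin_cons {β : Type*} [MeasurableSpace β] {T : ℕ} (b : β) :
    Measurable fun d : Fin T → β => (Fin.cons b d : Fin (T + 1) → β) := by
  refine measurable_pi_lambda _ fun i => ?_
  refine Fin.cases ?_ (fun j => ?_) i
  · simp
  · simpa using measurable_pi_apply j

variable {X H A ι : Type*} [Fintype A] [Fintype ι]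

/-- The total weight of trajectories of length `T` from `s` when the outcome and the next state
carry the weights `u`. -/
def survival (u : X × H → A → ι → ℝ) (z : X × H → A → ι → ℝ × (X × H)) (e : X → A → ℝ) :
    ℕ → X × H → ℝ
  | 0, _ => 1
  | T + 1, s => ∑ a, e s.1 a * ∑ i, u s a i * survival u z e T (z s a i).2

theorem survival_nonneg {u : X × H → A → ι → ℝ} {z : X × H → A → ι → ℝ × (X × H)}
    {e : X → A → ℝ} (hu : ∀ s a i, 0 ≤ u s a i) (he : ∀ x a, 0 ≤ e x a) (T : ℕ) (s : X × H) :
    0 ≤ survival u z e T s := by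
  induction T generalizing s with
  | zero => simp [survival]
  | succ T ih =>
    exact Finset.sum_nonneg fun a _ => mul_nonneg (he _ _) <|
      Finset.sum_nonneg fun i _ => mul_nonneg (hu _ _ _) (ih _)

variable [MeasurableSpace X] [MeasurableSpace H] [MeasurableSpace A]

theorem lintegral_trajLaw_succ [MeasurableSingletonClass X] [MeasurableSingletonClass H]
    (w : X × H → A → ι → ℝ) (z : X × H → A → ι → ℝ × (X × H)) (e : X → A → ℝ) (T : ℕ)
    (s : X × H) {f : (Fin (T + 1) → (X × H) × A × ℝ) → ℝ≥0∞} (hf : Measurable f) :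
    ∫⁻ d, f d ∂trajLaw (fun s a => atomic (w s a) (z s a)) e (T + 1) s =
      ∑ a, ENNReal.ofReal (e s.1 a) * ∑ i, ENNReal.ofReal (w s a i) *
        ∫⁻ d, f (Fin.cons (s, a, (z s a i).1) d)
          ∂trajLaw (fun s a => atomic (w s a) (z s a)) e T (z s a i).2 := by
  rw [trajLaw, lintegral_finsetSum_measure]
  refine Finset.sum_congr rfl fun a _ => ?_
  rw [lintegral_smul_measure, smul_eq_mul, Measure.lintegral_bind (aemeasurable_atomic _ _ _)
    hf.aemeasurable, lintegral_atomic]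
  congr 1
  refine Finset.sum_congr rfl fun i _ => ?_
  rw [lintegral_map hf (measurable_fin_cons _)]

/-- If `u` is at most the geometric mean of `w` and `w'`, then the affinity of the trajectory
laws with weights `w` and `w'` is at least the total weight of `u`. -/
theorem survival_le_affinity [MeasurableSingletonClass X] [MeasurableSingletonClass H]
    {u w w' : X × H → A → ι → ℝ} {z : X × H → A → ι → ℝ × (X × H)} {e : X → A → ℝ}
    (he : ∀ x a, 0 ≤ e x a) (hu : ∀ s a i, 0 ≤ u s a i) (hw : ∀ s a i, 0 ≤ w s a i)
    (hw' : ∀ s a i, 0 ≤ w' s a i) (h : ∀ s a i, u s a i ^ 2 ≤ w s a i * w' s a i)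
    (T : ℕ) (s : X × H) {f g : (Fin T → (X × H) × A × ℝ) → ℝ≥0∞} (hf : Measurable f)
    (hg : Measurable g) (hfg : ∀ d, 1 ≤ f d * g d) :
    ENNReal.ofReal (survival u z e T s) ≤
      (∫⁻ d, f d ∂trajLaw (fun s a => atomic (w s a) (z s a)) e T s) ^ (1 / 2 : ℝ) *
      (∫⁻ d, g d ∂trajLaw (fun s a => atomic (w' s a) (z s a)) e T s) ^ (1 / 2 : ℝ) := by
  induction T generalizing s with
  | zero =>
    rw [trajLaw, trajLaw, lintegral_dirac' _ hf, lintegral_dirac' _ hg,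
      ← ENNReal.mul_rpow_of_nonneg _ _ (by norm_num)]
    simpa [survival] using ENNReal.one_le_rpow (hfg Fin.elim0) (by norm_num : (0 : ℝ) < 1 / 2)
  | succ T ih =>
    rw [lintegral_trajLaw_succ _ _ _ _ _ hf, lintegral_trajLaw_succ _ _ _ _ _ hg, survival,
      ENNReal.ofReal_sum_of_nonneg fun a _ => mul_nonneg (he _ _) <|
        Finset.sum_nonneg fun i _ => mul_nonneg (hu _ _ _) (survival_nonneg hu he _ _)]
    -- Cauchy–Schwarz is applied twice, over the action (same weights under both laws) and over the
    -- atom (weights `w` and `w'`). The induction hypothesis then handles the tests `f` and `g` with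
    -- their first coordinate frozen.
    refine sum_le_sqrt_mul_sqrt fun a => ?_
    refine ofReal_mul_le_sqrt_mul_sqrt (he _ _) (he _ _) (he _ _) (sq _).le ?_
    rw [ENNReal.ofReal_sum_of_nonneg fun i _ =>
      mul_nonneg (hu _ _ _) (survival_nonneg hu he _ _)]
    refine sum_le_sqrt_mul_sqrt fun i => ?_
    refine ofReal_mul_le_sqrt_mul_sqrt (hu _ _ _) (hw _ _ _) (hw' _ _ _) (h _ _ _) ?_
    exact ih _ (hf.comp (measurable_fin_cons _)) (hg.comp (measurable_fin_cons _)) fun d => hfg _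

end Affinity

/-! ### Chains that reset -/

section Reset

variable {S : Type*} [Fintype S] [DecidableEq S]

/-- The chain that moves from `s` to `g s` with probability `q` and to `o` otherwise. -/
def resetChain (q : ℝ) (g : S → S) (o : S) : Matrix S S ℝ :=
  fun s s' => q * (if g s = s' then 1 else 0) + (1 - q) * if o = s' then 1 else 0

theorem sum_resetChain_mul (q : ℝ) (g : S → S) (o s : S) (φ : S → ℝ) :
    ∑ s', resetChain q g o s s' * φ s' = q * φ (g s) + (1 - q) * φ o := by
  simp [resetChain, add_mul, Finset.sum_add_distrib]

theorem resetChain_mem_stdSimplex {q : ℝ} (h0 : 0 ≤ q) (h1 : q ≤ 1) (g : S → S) (o s : S) :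
    resetChain q g o s ∈ stdSimplex ℝ S := by
  refine ⟨fun s' => ?_, by simpa using sum_resetChain_mul q g o s 1⟩
  have : 0 ≤ 1 - q := by linarith
  unfold resetChain
  split_ifs <;> positivity

/-- The reset part sends every distribution to the same multiple of the point mass at `o`, so it
cancels in differences. What remains is `q` times a push-forward along `g`, which does not increase
the `ℓ¹` norm. -/
theorem mixesWithin_resetChain {q t : ℝ} (h0 : 0 ≤ q) (hq : q ≤ Real.exp (-1 / t)) (g : S → S)
    (o : S) : MixesWithin (resetChain q g o) t := by
  intro f hf f' hf'
  have key : ∀ s', Matrix.vecMul f' (resetChain q g o) s' - Matrix.vecMul f (resetChain q g o) s' =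
      q * ∑ s, (f' s - f s) * if g s = s' then 1 else 0 := by
    intro s'
    have : ∀ f : S → ℝ, Matrix.vecMul f (resetChain q g o) s' =
        q * ∑ s, f s * (if g s = s' then 1 else 0) +
          (∑ s, f s) * ((1 - q) * if o = s' then 1 else 0) := by
      intro f
      rw [Matrix.vecMul, dotProduct, Finset.mul_sum, Finset.sum_mul, ← Finset.sum_add_distrib]
      refine Finset.sum_congr rfl fun s _ => ?_
      rw [resetChain]; ring
    rw [this, this, hf.2, hf'.2]
    simp only [sub_mul, Finset.sum_sub_distrib]
    ring
  calc ∑ s', |Matrix.vecMul f' (resetChain q g o) s' - Matrix.vecMul f (resetChain q g o) s'|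
      ≤ ∑ s', q * ∑ s, |f' s - f s| * if g s = s' then 1 else 0 := by
        refine Finset.sum_le_sum fun s' _ => ?_
        rw [key, abs_mul, abs_of_nonneg h0]
        refine mul_le_mul_of_nonneg_left ?_ h0
        refine (Finset.abs_sum_le_sum_abs _ _).trans (Finset.sum_le_sum fun s _ => ?_)
        rw [abs_mul]
        split_ifs <;> simp
    _ = q * ∑ s, |f' s - f s| := by
        rw [← Finset.mul_sum, Finset.sum_comm]
        simp
    _ ≤ _ := mul_le_mul_of_nonneg_right hq (Finset.sum_nonneg fun _ _ => abs_nonneg _)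

theorem IsStationary.sum_resetChain {q : ℝ} {g : S → S} {o : S} {ρ : S → ℝ}
    (h : IsStationary (resetChain q g o) ρ) (φ : S → ℝ) :
    ∑ s, ρ s * φ s = ∑ s, ρ s * (q * φ (g s) + (1 - q) * φ o) := by
  conv_lhs => rw [← h.2]
  simp only [Matrix.vecMul, dotProduct, Finset.sum_mul, ← sum_resetChain_mul, Finset.mul_sum]
  rw [Finset.sum_comm]
  simp only [mul_assoc]

end Reset

/-! ### A hidden ladder -/

section Ladder

variable {k : ℕ}

/-- One step up the ladder `{0, …, k}`; the top stays put. -/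
def climb (s : Fin 1 × Fin (k + 1)) : Fin 1 × Fin (k + 1) :=
  (0, ⟨min (s.2 + 1) k, by omega⟩)

/-- In equilibrium, being at level at least `j + 1` means having climbed, with probability `q`, from
level at least `j`. The tail probabilities are therefore geometric, and the tail at `k` is the top
alone. -/
theorem IsStationary.apply_last {q : ℝ} {ρ : Fin 1 × Fin (k + 1) → ℝ}
    (h : IsStationary (resetChain q climb (0, 0)) ρ) : ρ (0, Fin.last k) = q ^ k := by
  have tail : ∀ j ≤ k, ∑ s, ρ s * (if j ≤ s.2.val then 1 else 0) = q ^ j := by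
    intro j
    induction j with
    | zero => intro _; simpa using h.1.2
    | succ j ih =>
      intro hj
      rw [h.sum_resetChain, pow_succ, ← ih (by omega), Finset.sum_mul]
      refine Finset.sum_congr rfl fun s _ => ?_
      -- The cap at `k` is harmless because `j + 1 ≤ k`.
      have : j + 1 ≤ (climb s).2.val ↔ j ≤ s.2.val := by
        simp only [climb]; omega
      simp only [this]
      simp
  rw [← tail k le_rfl, Finset.sum_eq_single (0, Fin.last k)]
  · simp
  · rintro ⟨x, j⟩ _ hne
    have : ¬ k ≤ j.val := fun hkj => hne <| by
      ext
      · simp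
      · simp only [Fin.val_last]; omega
    simp [this]
  · simp

/-- Action `1` with probability `p`, action `0` otherwise. -/
def ladderPolicy (p : ℝ) (_ : Fin 1) (a : Fin 2) : ℝ := if a = 1 then p else 1 - p

theorem ladderPolicy_mem {p : ℝ} (hp : p ∈ Set.Icc (0 : ℝ) 1) (x : Fin 1) :
    ladderPolicy p x ∈ stdSimplex ℝ (Fin 2) := by
  refine ⟨fun a => ?_, by simp [ladderPolicy]⟩
  unfold ladderPolicy
  split_ifs <;> linarith [hp.1, hp.2]

/-- The probability of climbing (`u = true`) or falling (`u = false`) after the action `a`. -/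
def moveWeight (r : ℝ) (a : Fin 2) (u : Bool) : ℝ :=
  if a = 1 then (if u then r else 1 - r) else if u then 0 else 1

/-- The probability of a positive (`b = true`) or negative (`b = false`) outcome: it is biased, by
`ε`, only at the top of the ladder. -/
def outcomeWeight (ε : ℝ) (s : Fin 1 × Fin (k + 1)) (b : Bool) : ℝ :=
  (1 + (if b then 1 else -1) * if s.2 = Fin.last k then ε else 0) / 2

/-- The joint probability of the sign of the outcome and of the move. -/
def ladderWeight (ε r : ℝ) (s : Fin 1 × Fin (k + 1)) (a : Fin 2) (i : Bool × Bool) : ℝ :=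
  outcomeWeight ε s i.1 * moveWeight r a i.2

/-- The outcome and the next state, given the sign of the outcome and the move. -/
def ladderPoint (c : ℝ) (s : Fin 1 × Fin (k + 1)) (_ : Fin 2) (i : Bool × Bool) :
    ℝ × (Fin 1 × Fin (k + 1)) :=
  (if i.1 then c else -c, if i.2 then climb s else (0, 0))

theorem moveWeight_nonneg {r : ℝ} (hr : r ∈ Set.Icc (0 : ℝ) 1) (a : Fin 2) (u : Bool) :
    0 ≤ moveWeight r a u := by
  unfold moveWeight
  split_ifs <;> linarith [hr.1, hr.2]

theorem outcomeWeight_nonneg {ε : ℝ} (hε : ε ∈ Set.Icc (-1 : ℝ) 1) (s : Fin 1 × Fin (k + 1))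
    (b : Bool) : 0 ≤ outcomeWeight ε s b := by
  unfold outcomeWeight
  split_ifs <;> linarith [hε.1, hε.2]

theorem ladderWeight_nonneg {ε r : ℝ} (hε : ε ∈ Set.Icc (-1 : ℝ) 1) (hr : r ∈ Set.Icc (0 : ℝ) 1)
    (s : Fin 1 × Fin (k + 1)) (a : Fin 2) (i : Bool × Bool) : 0 ≤ ladderWeight ε r s a i :=
  mul_nonneg (outcomeWeight_nonneg hε _ _) (moveWeight_nonneg hr _ _)

theorem sum_moveWeight (r : ℝ) (a : Fin 2) : ∑ u, moveWeight r a u = 1 := by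
  fin_cases a <;> simp [moveWeight]

theorem sum_outcomeWeight (ε : ℝ) (s : Fin 1 × Fin (k + 1)) : ∑ b, outcomeWeight ε s b = 1 := by
  rw [Fintype.sum_bool]
  simp only [outcomeWeight]
  by_cases h : s.2 = Fin.last k <;> simp [h] <;> ring

/-- Factorization of expectations: given state and action, the sign of the outcome and the move are
independent. -/
theorem sum_mul_product {u v : Bool → ℝ} (φ ψ : Bool → ℝ) :
    ∑ i : Bool × Bool, u i.1 * v i.2 * (φ i.1 * ψ i.2) = (∑ b, u b * φ b) * ∑ b, v b * ψ b := by
  rw [Finset.sum_mul_sum, Fintype.sum_prod_type]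
  simp only [mul_mul_mul_comm]

theorem sum_ladderWeight (ε r : ℝ) (s : Fin 1 × Fin (k + 1)) (a : Fin 2) :
    ∑ i, ladderWeight ε r s a i = 1 := by
  have := sum_mul_product (u := outcomeWeight ε s) (v := moveWeight r a) 1 1
  simpa only [Pi.one_apply, mul_one, sum_moveWeight, sum_outcomeWeight, ladderWeight] using this

theorem sum_ladderPolicy_moveWeight (p r : ℝ) (x : Fin 1) (y z : ℝ) :
    ∑ a, ladderPolicy p x a * ∑ u, moveWeight r a u * (if u then y else z) =
      r * p * y + (1 - r * p) * z := by
  simp [ladderPolicy, moveWeight]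
  ring

/-- One observed state and two actions; the target policy always plays `1`, the behavior policy does
so with probability `p`. -/
def ladderDesign {p : ℝ} (hp : p ∈ Set.Icc (0 : ℝ) 1) : Design where
  nX := 1
  nA := 2
  target := ladderPolicy 1
  behavior := ladderPolicy p
  target_mem := ladderPolicy_mem (by simp)
  behavior_mem := ladderPolicy_mem hp

/-- The problem instance on the ladder of height `k`, whose top is reached by playing `1`, with
outcomes `± c`. -/
def ladder (k : ℕ) (c : ℝ) {p r ε : ℝ} (hp : p ∈ Set.Icc (0 : ℝ) 1) (hr : r ∈ Set.Icc (0 : ℝ) 1)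
    (hε : ε ∈ Set.Icc (-1 : ℝ) 1) : Instance where
  toDesign := ladderDesign hp
  nH := k + 1
  kernel := fun s a => atomic (ladderWeight ε r s a) (ladderPoint c s a)
  isProb := fun _ _ => isProbabilityMeasure_atomic (ladderWeight_nonneg hε hr _ _)
    (sum_ladderWeight _ _ _ _) _

variable {c p r ε : ℝ}

theorem transition_ladder (hp : p ∈ Set.Icc (0 : ℝ) 1) (hr : r ∈ Set.Icc (0 : ℝ) 1)
    (hε : ε ∈ Set.Icc (-1 : ℝ) 1) (p' : ℝ) :
    (ladder k c hp hr hε).transition (ladderPolicy p') = resetChain (r * p') climb (0, 0) := by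
  refine Matrix.ext ?_
  change ∀ s s' : Fin 1 × Fin (k + 1), ∑ a, ladderPolicy p' s.1 a *
    (atomic (ladderWeight ε r s a) (ladderPoint c s a)).real (Set.univ ×ˢ {s'}) = _
  intro s s'
  refine Eq.trans ?_ (sum_ladderPolicy_moveWeight p' r s.1 (if climb s = s' then 1 else 0)
    (if ((0, 0) : Fin 1 × Fin (k + 1)) = s' then 1 else 0))
  refine Finset.sum_congr rfl fun a _ => ?_
  rw [real_atomic (ladderWeight_nonneg hε hr _ _) _
    (MeasurableSet.univ.prod (MeasurableSet.singleton _))]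
  have := sum_mul_product (u := outcomeWeight ε s) (v := moveWeight r a) 1
    (fun u => if u then (if climb s = s' then 1 else 0) else if ((0, 0) : Fin 1 × Fin (k + 1)) = s' then 1 else 0)
  simp only [Pi.one_apply, mul_one, sum_outcomeWeight, one_mul] at this
  rw [← this]
  congr 1
  refine Finset.sum_congr rfl fun i _ => ?_
  rw [ladderWeight]
  congr 1
  rcases i with ⟨b, u⟩
  cases u <;> simp [ladderPoint]

theorem meanOutcome_ladder (hp : p ∈ Set.Icc (0 : ℝ) 1) (hr : r ∈ Set.Icc (0 : ℝ) 1)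
    (hε : ε ∈ Set.Icc (-1 : ℝ) 1) (s : Fin 1 × Fin (k + 1)) (a : Fin 2) :
    (ladder k c hp hr hε).meanOutcome s a = c * if s.2 = Fin.last k then ε else 0 := by
  change ∫ z, z.1 ∂atomic (ladderWeight ε r s a) (ladderPoint c s a) = _
  rw [integral_atomic (ladderWeight_nonneg hε hr _ _)]
  have := sum_mul_product (u := outcomeWeight ε s) (v := moveWeight r a)
    (fun b => if b then c else -c) 1
  simp only [Pi.one_apply, mul_one, sum_moveWeight] at this
  simp only [ladderWeight, ladderPoint, this]
  rw [Fintype.sum_bool]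
  simp only [outcomeWeight]
  by_cases h : s.2 = Fin.last k <;> simp [h] <;> ring

theorem isStationary_stationaryDist_resetChain {S : Type*} [Fintype S] [DecidableEq S]
    {q t : ℝ} (ht : 0 < t) (h0 : 0 ≤ q) (hq : q ≤ Real.exp (-1 / t)) (g : S → S) (o : S) :
    IsStationary (resetChain q g o) (stationaryDist (resetChain q g o)) := by
  have h1 : q ≤ 1 := hq.trans <| Real.exp_le_one_iff.2 <|
    (div_neg_of_neg_of_pos (by norm_num) ht).le
  have : Nonempty S := ⟨o⟩
  exact isStationary_stationaryDist
    (existsUnique_isStationary ht (resetChain_mem_stdSimplex h0 h1 g o)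
      (mixesWithin_resetChain h0 hq g o)).exists

theorem value_ladder (hp : p ∈ Set.Icc (0 : ℝ) 1) (hr : r ∈ Set.Icc (0 : ℝ) 1)
    (hε : ε ∈ Set.Icc (-1 : ℝ) 1) {t : ℝ} (ht : 0 < t) (hrt : r ≤ Real.exp (-1 / t)) :
    (ladder k c hp hr hε).value = r ^ k * (c * ε) := by
  have h := isStationary_stationaryDist_resetChain ht hr.1 hrt climb ((0, 0) : Fin 1 × Fin (k + 1))
  have hP := transition_ladder (k := k) (c := c) hp hr hε 1
  rw [mul_one] at hP
  have hsum : ∑ s : Fin 1 × Fin (k + 1), stationaryDist (resetChain r climb (0, 0)) s *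
      ∑ a : Fin 2, ladderPolicy 1 s.1 a * (c * if s.2 = Fin.last k then ε else 0) =
      r ^ k * (c * ε) := by
    rw [Finset.sum_eq_single (0, Fin.last k), h.apply_last]
    · simp [ladderPolicy]
    · rintro ⟨x, j⟩ _ hne
      have : j ≠ Fin.last k := fun hj => hne (Prod.ext (Subsingleton.elim _ _) hj)
      simp [this]
    · simp
  rw [← hsum, ← hP]
  refine Finset.sum_congr rfl fun s _ => ?_
  congr 1
  exact Finset.sum_congr rfl fun a _ => congrArg _ (meanOutcome_ladder hp hr hε s a)

theorem inClass_ladder (hp : p ∈ Set.Icc (0 : ℝ) 1) (hr : r ∈ Set.Icc (0 : ℝ) 1)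
    (hε : ε ∈ Set.Icc (-1 : ℝ) 1) {t₀ ζ M₁ M₂ : ℝ} (hr' : r = Real.exp (-1 / t₀)) (hp' : p = Real.exp (-ζ))
    (hc : 0 ≤ c) (hc₁ : c ≤ M₁) (hc₂ : c ^ 2 ≤ M₂) :
    (ladder k c hp hr hε).InClass t₀ ζ M₁ M₂ where
  nonempty := ⟨((0, 0) : Fin 1 × Fin (k + 1))⟩
  overlap := by
    change ∀ (x : Fin 1) (a : Fin 2), ladderPolicy 1 x a ≤ Real.exp ζ * ladderPolicy p x a
    intro x a
    unfold ladderPolicy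
    split_ifs
    · rw [hp', ← Real.exp_add]; simp
    · have := Real.exp_pos ζ
      nlinarith [hp.2]
  mixing_target := by
    change MixesWithin ((ladder k c hp hr hε).transition (ladderPolicy 1)) t₀
    rw [transition_ladder, mul_one]
    exact mixesWithin_resetChain hr.1 hr'.le _ _
  mixing_behavior := by
    change MixesWithin ((ladder k c hp hr hε).transition (ladderPolicy p)) t₀
    rw [transition_ladder]
    exact mixesWithin_resetChain (mul_nonneg hr.1 hp.1)
      ((mul_le_of_le_one_right hr.1 hp.2).trans hr'.le) _ _
  second_moment := by
    change ∀ (s : Fin 1 × Fin (k + 1)) (a : Fin 2),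
      ∫⁻ z, ENNReal.ofReal (z.1 ^ 2) ∂atomic (ladderWeight ε r s a) (ladderPoint c s a) ≤ _
    intro s a
    have hsq : ∀ i, (ladderPoint c s a i).1 ^ 2 = c ^ 2 := by
      intro i
      unfold ladderPoint
      split_ifs <;> simp
    rw [lintegral_atomic]
    simp only [hsq]
    rw [← Finset.sum_mul, ← ENNReal.ofReal_sum_of_nonneg fun i _ => ladderWeight_nonneg hε hr s a i,
      sum_ladderWeight]
    simpa using ENNReal.ofReal_le_ofReal hc₂
  first_moment := by
    intro s a
    refine Eq.trans_le (congrArg abs (meanOutcome_ladder hp hr hε s a)) ?_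
    rw [abs_mul, abs_of_nonneg hc]
    refine (mul_le_of_le_one_right hc ?_).trans hc₁
    split_ifs
    · exact abs_le.2 hε
    · simp

/-- A lower bound for the geometric mean of the ladder weights with biases `ε` and `-ε`. -/
def commonWeight (ε r : ℝ) (s : Fin 1 × Fin (k + 1)) (a : Fin 2) (i : Bool × Bool) : ℝ :=
  (1 - if s.2 = Fin.last k then ε ^ 2 else 0) / 2 * moveWeight r a i.2

theorem bias_sq_mem (hε : ε ∈ Set.Icc (-1 : ℝ) 1)
    (s : Fin 1 × Fin (k + 1)) :
    (if s.2 = Fin.last k then ε ^ 2 else 0) ∈ Set.Icc (0 : ℝ) 1 := by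
  have : ε ^ 2 ≤ 1 := sq_le_one_iff_abs_le_one _ |>.2 (abs_le.2 hε)
  split_ifs <;> simp [this, sq_nonneg]

theorem commonWeight_nonneg (hr : r ∈ Set.Icc (0 : ℝ) 1) (hε : ε ∈ Set.Icc (-1 : ℝ) 1)
    (s : Fin 1 × Fin (k + 1)) (a : Fin 2) (i : Bool × Bool) :
    0 ≤ commonWeight ε r s a i :=
  mul_nonneg (by linarith [(bias_sq_mem hε s).2]) (moveWeight_nonneg hr _ _)

/-- At the top the geometric mean of the outcome weights is `√(1 - ε ^ 2) / 2`, which dominates `(1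
- ε ^ 2) / 2`. The smaller weight avoids the root and still loses only order `ε ^ 2`. -/
theorem commonWeight_sq_le (hε : ε ∈ Set.Icc (-1 : ℝ) 1)
    (s : Fin 1 × Fin (k + 1)) (a : Fin 2) (i : Bool × Bool) :
    commonWeight ε r s a i ^ 2 ≤ ladderWeight ε r s a i * ladderWeight (-ε) r s a i := by
  rw [commonWeight, ladderWeight, ladderWeight, mul_pow, mul_mul_mul_comm, ← sq (moveWeight _ _ _)]
  refine mul_le_mul_of_nonneg_right ?_ (sq_nonneg _)
  have := bias_sq_mem hε s
  have h2 : outcomeWeight ε s i.1 * outcomeWeight (-ε) s i.1 =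
      (1 - if s.2 = Fin.last k then ε ^ 2 else 0) / 4 := by
    unfold outcomeWeight
    split_ifs <;> ring
  rw [h2]
  nlinarith [this.1, this.2]

/-- The total weight of trajectories on the ladder that carry the common weights. -/
def ladderSurvival (k : ℕ) (c p r ε : ℝ) (T : ℕ) : Fin 1 × Fin (k + 1) → ℝ :=
  survival (commonWeight ε r) (ladderPoint c) (ladderPolicy p) T

theorem ladderSurvival_nonneg (hp : p ∈ Set.Icc (0 : ℝ) 1) (hr : r ∈ Set.Icc (0 : ℝ) 1)
    (hε : ε ∈ Set.Icc (-1 : ℝ) 1) (T : ℕ) (s : Fin 1 × Fin (k + 1)) :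
    0 ≤ ladderSurvival k c p r ε T s :=
  survival_nonneg (commonWeight_nonneg hr hε) (fun x a => (ladderPolicy_mem hp x).1 a) T s

theorem ladderSurvival_succ (c p : ℝ) (T : ℕ) (s : Fin 1 × Fin (k + 1)) :
    ladderSurvival k c p r ε (T + 1) s =
      (1 - if s.2 = Fin.last k then ε ^ 2 else 0) *
        (r * p * ladderSurvival k c p r ε T (climb s) +
          (1 - r * p) * ladderSurvival k c p r ε T (0, 0)) := by
  rw [← sum_ladderPolicy_moveWeight p r s.1 (ladderSurvival k c p r ε T (climb s))
    (ladderSurvival k c p r ε T (0, 0)), Finset.mul_sum]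
  change ∑ a, ladderPolicy p s.1 a * ∑ i, commonWeight ε r s a i *
    ladderSurvival k c p r ε T (ladderPoint c s a i).2 = _
  refine Finset.sum_congr rfl fun a _ => ?_
  rw [mul_left_comm]
  congr 1
  simp [Fintype.sum_prod_type, commonWeight, ladderPoint]
  ring

theorem ladderSurvival_le_one (hp : p ∈ Set.Icc (0 : ℝ) 1) (hr : r ∈ Set.Icc (0 : ℝ) 1) (hε : ε ∈ Set.Icc (-1 : ℝ) 1)
    (T : ℕ) (s : Fin 1 × Fin (k + 1)) :
    ladderSurvival k c p r ε T s ≤ 1 := by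
  induction T generalizing s with
  | zero => simp [ladderSurvival, survival]
  | succ T ih =>
    rw [ladderSurvival_succ]
    have h1 : 0 ≤ r * p := mul_nonneg hr.1 hp.1
    have h2 : r * p ≤ 1 := mul_le_one₀ hr.2 hp.1 hp.2
    have hb := bias_sq_mem hε s
    have h3 : r * p * ladderSurvival k c p r ε T (climb s) +
          (1 - r * p) * ladderSurvival k c p r ε T (0, 0) ≤ 1 := by
      nlinarith [ih (climb s), ih (0, 0)]
    nlinarith [hb.1, hb.2]

/-- A union bound over time: started in equilibrium, the chain is at the top with probability `(r *
p) ^ k` at every step, and a visit there destroys at most the fraction `ε ^ 2` of the weight. -/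
theorem one_sub_le_sum_ladderSurvival (hp : p ∈ Set.Icc (0 : ℝ) 1) (hr : r ∈ Set.Icc (0 : ℝ) 1) (hε : ε ∈ Set.Icc (-1 : ℝ) 1)
    {ρ : Fin 1 × Fin (k + 1) → ℝ}
    (h : IsStationary (resetChain (r * p) climb (0, 0)) ρ) (T : ℕ) :
    1 - T * ((r * p) ^ k * ε ^ 2) ≤
      ∑ s, ρ s * ladderSurvival k c p r ε T s := by
  induction T with
  | zero => simp [ladderSurvival, survival, h.1.2]
  | succ T ih =>
    -- Stationarity advances the chain one step in the hypothesis, matching the bracket in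
    -- `ladderSurvival_succ`.
    rw [h.sum_resetChain] at ih
    have htop : ∑ s, ρ s * (if s.2 = Fin.last k then ε ^ 2 else 0) = (r * p) ^ k * ε ^ 2 := by
      rw [Finset.sum_eq_single (0, Fin.last k), h.apply_last]
      · simp
      · rintro ⟨x, j⟩ _ hne
        have : j ≠ Fin.last k := fun hj => hne (Prod.ext (Subsingleton.elim _ _) hj)
        simp [this]
      · simp
    have hstep : ∑ s, ρ s * (r * p * ladderSurvival k c p r ε T (climb s) + (1 - r * p) *
            ladderSurvival k c p r ε T (0, 0)) -
        ∑ s, ρ s * (if s.2 = Fin.last k then ε ^ 2 else 0) ≤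
        ∑ s, ρ s * ladderSurvival k c p r ε (T + 1) s := by
      rw [← Finset.sum_sub_distrib]
      refine Finset.sum_le_sum fun s _ => ?_
      rw [← mul_sub, ladderSurvival_succ]
      refine mul_le_mul_of_nonneg_left ?_ (h.1.1 s)
      have h1 : 0 ≤ r * p := mul_nonneg hr.1 hp.1
      have h2 : r * p ≤ 1 := mul_le_one₀ hr.2 hp.1 hp.2
      have hb := bias_sq_mem hε s
      have h3 : r * p * ladderSurvival k c p r ε T (climb s) +
          (1 - r * p) * ladderSurvival k c p r ε T (0, 0) ≤ 1 := by
        nlinarith [ladderSurvival_le_one (c := c) hp hr hε T (climb s),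
          ladderSurvival_le_one (k := k) (c := c) hp hr hε T (0, 0)]
      nlinarith [hb.1, hb.2]
    push_cast
    linarith

end Ladder

/-! ### The two-point lower bound on the risk -/

section Risk

theorem lintegral_sum_smul_measure {ι α : Type*} [Fintype ι] [MeasurableSpace α] (w : ι → ℝ≥0∞)
    (μ : ι → Measure α) (f : α → ℝ≥0∞) :
    ∫⁻ x, f x ∂∑ i, w i • μ i = ∑ i, w i * ∫⁻ x, f x ∂μ i := by
  simp [lintegral_smul_measure]

theorem measurable_observe {X H A : Type*} [MeasurableSpace X] [MeasurableSpace H]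
    [MeasurableSpace A] {T : ℕ} :
    Measurable (observe : (Fin T → (X × H) × A × ℝ) → Fin T → X × A × ℝ) := by
  unfold observe
  fun_prop

variable {k : ℕ} {c p r ε : ℝ}

/-- The law of a trajectory on the ladder. -/
def ladderTraj (k : ℕ) (c p r ε : ℝ) (T : ℕ) (s : Fin 1 × Fin (k + 1)) :
    Measure (Fin T → (Fin 1 × Fin (k + 1)) × Fin 2 × ℝ) :=
  trajLaw (fun s a => atomic (ladderWeight ε r s a) (ladderPoint c s a)) (ladderPolicy p) T s

theorem lintegral_const_ladderTraj (hp : p ∈ Set.Icc (0 : ℝ) 1) (hr : r ∈ Set.Icc (0 : ℝ) 1)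
    (hε : ε ∈ Set.Icc (-1 : ℝ) 1) (b : ℝ≥0∞) (T : ℕ) (s : Fin 1 × Fin (k + 1)) :
    ∫⁻ _, b ∂ladderTraj k c p r ε T s = b := by
  induction T generalizing s with
  | zero => simp [ladderTraj, trajLaw]
  | succ T ih =>
    rw [ladderTraj, lintegral_trajLaw_succ _ _ _ _ _ measurable_const]
    have h : ∀ s, ∫⁻ _, b ∂trajLaw (fun s a => atomic (ladderWeight ε r s a) (ladderPoint c s a))
      (ladderPolicy p) T s = b := ih
    simp only [h]
    simp only [← Finset.sum_mul]
    simp only [← ENNReal.ofReal_sum_of_nonneg fun i _ => ladderWeight_nonneg hε hr s _ i,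
      sum_ladderWeight, ENNReal.ofReal_one, one_mul]
    rw [← Finset.sum_mul,
      ← ENNReal.ofReal_sum_of_nonneg fun a _ => (ladderPolicy_mem hp _).1 a,
      (ladderPolicy_mem hp _).2, ENNReal.ofReal_one, one_mul]

/-- The design does not involve `ε`, so the same function of the data is judged under both biases.
Pulling it back along `observe` allows comparison of the full trajectory laws. -/
theorem mse_ladder (hp : p ∈ Set.Icc (0 : ℝ) 1) (hr : r ∈ Set.Icc (0 : ℝ) 1)
    (hε : ε ∈ Set.Icc (-1 : ℝ) 1) {t : ℝ} (ht : 0 < t) (hrt : r ≤ Real.exp (-1 / t)) {T : ℕ}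
    (v : Estimator T) :
    mse v (ladder k c hp hr hε) =
      ∑ s, ENNReal.ofReal (stationaryDist (resetChain (r * p) climb (0, 0)) s) *
        ∫⁻ d, ENNReal.ofReal (((v (ladderDesign hp)).1 (observe d) - r ^ k * (c * ε)) ^ 2)
          ∂ladderTraj k c p r ε T s := by
  have hm : Measurable fun d => ENNReal.ofReal
      (((v (ladderDesign hp)).1 d - r ^ k * (c * ε)) ^ 2) :=
    (((v (ladderDesign hp)).2.sub_const _).pow_const 2).ennreal_ofReal
  rw [mse, value_ladder hp hr hε ht hrt]
  have hP := transition_ladder (k := k) (c := c) hp hr hε p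
  rw [← hP]
  exact (lintegral_map hm measurable_observe).trans (lintegral_sum_smul_measure _ _ _)

/-- A two-point bound: the ladders with biases `ε` and `-ε` cannot be told apart. -/
theorem le_minimaxRisk_of_ladder {t₀ ζ M₁ M₂ : ℝ} (ht₀ : 0 < t₀) (hζ : 0 ≤ ζ) (hc : 0 < c)
    (hc₁ : c ≤ M₁) (hc₂ : c ^ 2 ≤ M₂) (k T : ℕ) (hε₀ : 0 < ε) (hε₁ : ε ≤ 1)
    (h : T * ((Real.exp (-1 / t₀) * Real.exp (-ζ)) ^ k * ε ^ 2) ≤ 1 / 8) :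
    ENNReal.ofReal ((Real.exp (-1 / t₀) ^ k * (c * ε)) ^ 2 / 4) ≤ minimaxRisk T t₀ ζ M₁ M₂ := by
  obtain ⟨r, hr'⟩ : ∃ r, r = Real.exp (-1 / t₀) := ⟨_, rfl⟩
  obtain ⟨p, hp'⟩ : ∃ p, p = Real.exp (-ζ) := ⟨_, rfl⟩
  rw [← hr', ← hp'] at h
  rw [← hr']
  have hr0 : 0 < r := hr' ▸ Real.exp_pos _
  have hr : r ∈ Set.Icc (0 : ℝ) 1 := ⟨hr0.le, hr' ▸ Real.exp_le_one_iff.2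
    (div_neg_of_neg_of_pos (by norm_num) ht₀).le⟩
  have hp : p ∈ Set.Icc (0 : ℝ) 1 := ⟨hp' ▸ (Real.exp_pos _).le, hp' ▸ Real.exp_le_one_iff.2
    (by linarith)⟩
  have hε : ε ∈ Set.Icc (-1 : ℝ) 1 := ⟨by linarith, hε₁⟩
  have hε' : -ε ∈ Set.Icc (-1 : ℝ) 1 := ⟨by linarith, by linarith⟩
  obtain ⟨ρ, hρ⟩ : ∃ ρ, ρ = stationaryDist (resetChain (r * p) climb
    ((0, 0) : Fin 1 × Fin (k + 1))) := ⟨_, rfl⟩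
  have hst : IsStationary (resetChain (r * p) climb (0, 0)) ρ := hρ ▸
    isStationary_stationaryDist_resetChain ht₀ (mul_nonneg hr.1 hp.1)
      ((mul_le_of_le_one_right hr.1 hp.2).trans hr'.le) _ _
  obtain ⟨Δ, hΔ⟩ : ∃ Δ, Δ = r ^ k * (c * ε) := ⟨_, rfl⟩
  have hΔ0 : 0 < Δ := hΔ ▸ by positivity
  rw [← hΔ]
  refine le_iInf fun v => ?_
  by_contra! hlt
  have hmse : ∀ {ε'} (hε' : ε' ∈ Set.Icc (-1 : ℝ) 1),
      mse v (ladder k c hp hr hε') ≤ ENNReal.ofReal (Δ ^ 2 / 4) := fun hε' =>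
    (le_iSup₂_of_le (ladder k c hp hr hε') (inClass_ladder hp hr hε' hr' hp' hc.le hc₁ hc₂)
      le_rfl).trans hlt.le
  have hm₁ := hmse hε
  have hm₂ := hmse hε'
  rw [mse_ladder hp hr _ ht₀ hr'.le, ← hρ] at hm₁ hm₂
  rw [← hΔ] at hm₁
  rw [mul_neg, mul_neg, ← hΔ] at hm₂
  obtain ⟨V, hV, hVdef⟩ : ∃ V : (Fin T → (Fin 1 × Fin (k + 1)) × Fin 2 × ℝ) → ℝ, Measurable V ∧
    V = fun d => (v (ladderDesign hp)).1 (observe d) :=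
    ⟨_, (v (ladderDesign hp)).2.comp measurable_observe, rfl⟩
  have hm₁ : ∑ s, ENNReal.ofReal (ρ s) * ∫⁻ d, ENNReal.ofReal ((V d - Δ) ^ 2)
      ∂ladderTraj k c p r ε T s ≤ ENNReal.ofReal (Δ ^ 2 / 4) := by
    rw [hVdef]; exact hm₁
  have hm₂ : ∑ s, ENNReal.ofReal (ρ s) * ∫⁻ d, ENNReal.ofReal ((V d - -Δ) ^ 2)
      ∂ladderTraj k c p r (-ε) T s ≤ ENNReal.ofReal (Δ ^ 2 / 4) := by
    rw [hVdef]; exact hm₂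
  have hbound : ∀ (ε' Δ' a b : ℝ), ε' ∈ Set.Icc (-1 : ℝ) 1 → 0 ≤ a → 0 ≤ b →
      ∑ s, ENNReal.ofReal (ρ s) * ∫⁻ d, ENNReal.ofReal ((V d - Δ') ^ 2)
        ∂ladderTraj k c p r ε' T s ≤ ENNReal.ofReal (Δ ^ 2 / 4) →
      ∑ s, ENNReal.ofReal (ρ s) * ∫⁻ d, ENNReal.ofReal (a * (V d - Δ') ^ 2 + b)
        ∂ladderTraj k c p r ε' T s ≤ ENNReal.ofReal (a * (Δ ^ 2 / 4) + b) := by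
    intro ε' Δ' a b hε' ha hb hle
    have hmeas : Measurable fun d => ENNReal.ofReal ((V d - Δ') ^ 2) :=
      ((hV.sub_const _).pow_const 2).ennreal_ofReal
    have hint : ∀ s, ∫⁻ d, ENNReal.ofReal (a * (V d - Δ') ^ 2 + b) ∂ladderTraj k c p r ε' T s =
        ENNReal.ofReal a * ∫⁻ d, ENNReal.ofReal ((V d - Δ') ^ 2) ∂ladderTraj k c p r ε' T s +
          ENNReal.ofReal b := by
      intro s
      simp only [ENNReal.ofReal_add (mul_nonneg ha (sq_nonneg _)) hb, ENNReal.ofReal_mul ha]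
      rw [lintegral_add_right _ measurable_const, lintegral_const_mul _ hmeas,
        lintegral_const_ladderTraj hp hr hε']
    simp only [hint, mul_add, Finset.sum_add_distrib, mul_left_comm _ (ENNReal.ofReal a)]
    rw [← Finset.mul_sum, ← Finset.sum_mul,
      ← ENNReal.ofReal_sum_of_nonneg fun s _ => hst.1.1 s, hst.1.2, ENNReal.ofReal_one, one_mul,
      ENNReal.ofReal_add (by positivity) hb, ENNReal.ofReal_mul ha]
    gcongr
  -- With `A` and `B` the squared errors around `Δ` and `-Δ` divided by `2 * Δ ^ 2`, the tests are
  -- `(A + 1) / 2` and `B + 1`. Since `A + B ≥ 1`, their product is at least `1`. Risks at most `Δ ^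
  -- 2 / 4` bound their means by `9/16` and `9/8`, so the affinity is at most `√(81/128) < 7/8`.
  have hb₁ := hbound ε Δ (1 / (4 * Δ ^ 2)) (1 / 2) hε (by positivity) (by norm_num) hm₁
  have hb₂ := hbound (-ε) (-Δ) (1 / (2 * Δ ^ 2)) 1 hε' (by positivity) (by norm_num) hm₂
  have hprod : ∀ d, 1 ≤ ENNReal.ofReal (1 / (4 * Δ ^ 2) * (V d - Δ) ^ 2 + 1 / 2) *
      ENNReal.ofReal (1 / (2 * Δ ^ 2) * (V d - -Δ) ^ 2 + 1) := by
    intro d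
    rw [← ENNReal.ofReal_mul (by positivity), ← ENNReal.ofReal_one]
    refine ENNReal.ofReal_le_ofReal ?_
    have h1 : 0 ≤ 1 / (2 * Δ ^ 2) * (V d - Δ) ^ 2 := by positivity
    have h2 : 0 ≤ 1 / (2 * Δ ^ 2) * (V d - -Δ) ^ 2 := by positivity
    have h3 : 1 / (2 * Δ ^ 2) * (V d - Δ) ^ 2 + 1 / (2 * Δ ^ 2) * (V d - -Δ) ^ 2 =
        1 + V d ^ 2 / Δ ^ 2 := by
      field_simp
      ring
    have h4 : 1 / (4 * Δ ^ 2) * (V d - Δ) ^ 2 = 1 / (2 * Δ ^ 2) * (V d - Δ) ^ 2 / 2 := by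
      field_simp
      ring
    have h5 : 0 ≤ V d ^ 2 / Δ ^ 2 := by positivity
    rw [h4]
    nlinarith [mul_nonneg h1 h2]
  have hsurv : ENNReal.ofReal (∑ s, ρ s * ladderSurvival k c p r ε T s) ≤
      (∑ s, ENNReal.ofReal (ρ s) * ∫⁻ d, ENNReal.ofReal (1 / (4 * Δ ^ 2) * (V d - Δ) ^ 2 + 1 / 2)
        ∂ladderTraj k c p r ε T s) ^ (1 / 2 : ℝ) *
      (∑ s, ENNReal.ofReal (ρ s) * ∫⁻ d, ENNReal.ofReal (1 / (2 * Δ ^ 2) * (V d - -Δ) ^ 2 + 1)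
        ∂ladderTraj k c p r (-ε) T s) ^ (1 / 2 : ℝ) := by
    rw [ENNReal.ofReal_sum_of_nonneg fun s _ => mul_nonneg (hst.1.1 s)
      (ladderSurvival_nonneg hp hr hε T s)]
    refine sum_le_sqrt_mul_sqrt fun s => ?_
    refine ofReal_mul_le_sqrt_mul_sqrt (hst.1.1 s) (hst.1.1 s) (hst.1.1 s) (sq _).le ?_
    exact survival_le_affinity (fun x a => (ladderPolicy_mem hp x).1 a)
      (commonWeight_nonneg hr hε) (ladderWeight_nonneg hε hr) (ladderWeight_nonneg hε' hr)
      (commonWeight_sq_le hε) T s (by fun_prop) (by fun_prop) hprod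
  have hfinal := hsurv.trans (mul_le_mul' (ENNReal.rpow_le_rpow hb₁ (by norm_num))
    (ENNReal.rpow_le_rpow hb₂ (by norm_num)))
  have e₁ : 1 / (4 * Δ ^ 2) * (Δ ^ 2 / 4) + 1 / 2 = 9 / 16 := by field_simp; norm_num
  have e₂ : 1 / (2 * Δ ^ 2) * (Δ ^ 2 / 4) + 1 = 9 / 8 := by field_simp; norm_num
  rw [e₁, e₂, ← ENNReal.mul_rpow_of_nonneg _ _ (by norm_num),
    ← ENNReal.ofReal_mul (by norm_num), ENNReal.ofReal_rpow_of_nonneg (by norm_num) (by norm_num),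
    ENNReal.ofReal_le_ofReal_iff (by positivity), ← Real.sqrt_eq_rpow] at hfinal
  have hlow := (one_sub_le_sum_ladderSurvival (c := c) hp hr hε hst T).trans hfinal
  have : Real.sqrt (9 / 16 * (9 / 8)) < 7 / 8 := by
    rw [Real.sqrt_lt' (by norm_num)]
    norm_num
  linarith

end Risk

end POMDP

end

/-! ### Choice of height and bias -/

theorem theorem2 (t₀ ζ M₁ M₂ : ℝ) (ht₀ : 0 < t₀) (hζ : 0 ≤ ζ) (hM₁ : 0 < M₁) (hM₂ : 0 < M₂) :
    ∃ C : ℝ, 0 < C ∧ ∀ T : ℕ, 1 ≤ T →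
      ENNReal.ofReal (C * max ((T : ℝ) ^ (-2 / (t₀ * ζ + 1))) ((T : ℝ) ^ (-1 : ℝ))) ≤
        POMDP.minimaxRisk T t₀ ζ M₁ M₂ := by
  obtain ⟨c, hc, hc₁, hc₂⟩ : ∃ c : ℝ, 0 < c ∧ c ≤ M₁ ∧ c ^ 2 ≤ M₂ := by
    refine ⟨min M₁ (Real.sqrt M₂), lt_min hM₁ (Real.sqrt_pos.2 hM₂), min_le_left _ _, ?_⟩
    calc (min M₁ (Real.sqrt M₂)) ^ 2 ≤ (Real.sqrt M₂) ^ 2 :=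
          pow_le_pow_left₀ (le_min hM₁.le (Real.sqrt_nonneg _)) (min_le_right _ _) 2
      _ = M₂ := Real.sq_sqrt hM₂.le
  set b : ℝ := 1 / t₀ + ζ with hb
  have hb0 : 0 < b := by positivity
  have hbt : t₀ * ζ + 1 = t₀ * b := by rw [hb]; field_simp; ring
  -- One constant per regime. In the second, the factor `exp (-2 / t₀)` pays for rounding the height
  -- up by less than one level, and the power of `8` comes from asking for `1 / (8 * T)` rather than
  -- `1 / T`.
  refine ⟨min (c ^ 2 / 32) (c ^ 2 / 4 * (Real.exp (-2 / t₀) * 8 ^ (-2 / (t₀ * ζ + 1)))),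
    by positivity, fun T hT => ?_⟩
  have hT0 : (0 : ℝ) < T := by exact_mod_cast hT
  have hT1 : (1 : ℝ) ≤ T := by exact_mod_cast hT
  rcases le_total ((T : ℝ) ^ (-2 / (t₀ * ζ + 1))) ((T : ℝ) ^ (-1 : ℝ)) with hle | hle
  · rw [max_eq_right hle]
    -- At height `0` the only level is the top, and this bias makes the affinity loss exactly `1/8`.
    have hsq : Real.sqrt (1 / (8 * T)) ^ 2 = 1 / (8 * T) := Real.sq_sqrt (by positivity)
    refine le_trans (ENNReal.ofReal_le_ofReal ?_)
      (POMDP.le_minimaxRisk_of_ladder (ε := Real.sqrt (1 / (8 * T))) ht₀ hζ hc hc₁ hc₂ 0 T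
        (Real.sqrt_pos.2 (by positivity)) (Real.sqrt_le_one.2 ?_) ?_)
    · rw [Real.rpow_neg_one, pow_zero, one_mul, mul_pow, hsq]
      refine (mul_le_mul_of_nonneg_right (min_le_left _ _) (by positivity)).trans (le_of_eq ?_)
      field_simp
      norm_num
    · rw [div_le_one (by positivity)]
      linarith
    · rw [pow_zero, one_mul, hsq]
      refine le_of_eq ?_
      field_simp
  · rw [max_eq_left hle]
    -- The least height at which the behavior policy's stationary probability of the top, `exp (-k *
    -- b)`, is at most `1 / (8 * T)`.
    set k : ℕ := ⌈Real.log (8 * T) / b⌉₊ with hk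
    have hlog : 0 ≤ Real.log (8 * T) := Real.log_nonneg (by linarith)
    have hk₁ : Real.log (8 * T) / b ≤ k := Nat.le_ceil _
    have hk₂ : (k : ℝ) < Real.log (8 * T) / b + 1 := Nat.ceil_lt_add_one (by positivity)
    refine le_trans (ENNReal.ofReal_le_ofReal ?_)
      (POMDP.le_minimaxRisk_of_ladder (ε := 1) ht₀ hζ hc hc₁ hc₂ k T one_pos le_rfl ?_)
    · refine (mul_le_mul_of_nonneg_right (min_le_right _ _) (by positivity)).trans ?_
      have hexp : Real.exp (-2 / t₀) * 8 ^ (-2 / (t₀ * ζ + 1)) * (T : ℝ) ^ (-2 / (t₀ * ζ + 1)) ≤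
          (Real.exp (-1 / t₀) ^ k) ^ 2 := by
        rw [mul_assoc, ← Real.mul_rpow (by norm_num) hT0.le, Real.rpow_def_of_pos (by positivity),
          ← Real.exp_add, ← Real.exp_nat_mul, ← Real.exp_nat_mul, Real.exp_le_exp, hbt]
        have : -2 / t₀ + Real.log (8 * T) * (-2 / (t₀ * b)) =
            -(2 / t₀ * (Real.log (8 * T) / b + 1)) := by
          field_simp
          ring
        rw [this]
        have h2 : ((2 : ℕ) : ℝ) * (k * (-1 / t₀)) = -(2 / t₀ * k) := by
          push_cast
          ring
        rw [h2]
        exact neg_le_neg (mul_le_mul_of_nonneg_left hk₂.le (by positivity))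
      calc _ = c ^ 2 / 4 * (Real.exp (-2 / t₀) * 8 ^ (-2 / (t₀ * ζ + 1)) *
            (T : ℝ) ^ (-2 / (t₀ * ζ + 1))) := by ring
        _ ≤ c ^ 2 / 4 * (Real.exp (-1 / t₀) ^ k) ^ 2 :=
            mul_le_mul_of_nonneg_left hexp (by positivity)
        _ = _ := by ring
    · have hq : (Real.exp (-1 / t₀) * Real.exp (-ζ)) ^ k ≤ 1 / (8 * T) := by
        rw [← Real.exp_add, ← Real.exp_nat_mul, one_div, ← Real.exp_log (x := (8 * T : ℝ)⁻¹)
          (by positivity), Real.exp_le_exp, Real.log_inv]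
        have h1 : (k : ℝ) * (-1 / t₀ + -ζ) = -(k * b) := by rw [hb]; ring
        rw [h1]
        exact neg_le_neg ((div_le_iff₀ hb0).1 hk₁)
      calc T * ((Real.exp (-1 / t₀) * Real.exp (-ζ)) ^ k * 1 ^ 2)
          ≤ T * (1 / (8 * T)) := by
            rw [one_pow, mul_one]
            exact mul_le_mul_of_nonneg_left hq hT0.le
        _ = 1 / 8 := by field_simp
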